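/- Let $\Gamma=\langle S\mid R\rangle$ be the Higman group, with $S=\{a,b,c,d,a^{-1},b^{-1},c^{-1},d^{-1}\}$ and $R=\{a^{-1}ba=b^2,\ b^{-1}cb=c^2,\ c^{-1}dc=d^2,\ d^{-1}ad=a^2\}$, and let $G$ be its Cayley graph: the simple graph with vertex set $\Gamma$ in which $\gamma_1,\gamma_2$ are adjacent if and only if $\gamma_2=\gamma_1s$ for some $s\in S$. Write $\mathbf 1$ for the identity of $\Gamma$. A *graph height function* on $G$ is a pair $(h,\mathcal H)$ in which $\mathcal H$ is a subgroup of $\mathrm{Aut}(G)$ acting quasi-transitively on $G$ (some finite set of vertices meets every $\mathcal H$-orbit) and $h:\Gamma\to\mathbb Z$ satisfies: (a) $h(\mathbf 1)=0$; (b) $h(v)-h(w)=h(\gamma v)-h(\gamma w)$ for all vertices $v,w$ and all $\gamma\in\mathcal H$; (c) every vertex $v$ has neighbours $u,w$ with $h(u)<h(v)<h(w)$. A *group height function* on $\Gamma$ is a function $h:\Gamma\to\mathbb Z$, not identically zero, with $h(\mathbf 1)=0$, such that $h(s_1\cdots s_m)=\sum_{i=1}^m h(s_i)$ for all $s_1,\dots,s_m\in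 S$, and $\sum_{i=1}^m h(s_i)=0$ whenever $s_1\cdots s_m=\mathbf 1$ with all $s_i\in S$. Then $G$ has no graph height function. Moreover: 1. $\Gamma$ has no group height function; 2. the stabiliser of the vertex $\mathbf 1$ in $\mathrm{Aut}(G)$ is the cyclic group generated by the automorphism of $G$ induced by the group automorphism $a\mapsto b\mapsto c\mapsto d\mapsto a$ of $\Gamma$; 3. $\Gamma$ has no proper normal subgroup of finite index. -/

import Mathlib

/-! ### Height functions on graphs and groups -/

/-- A group `H` of automorphisms of `G` acts quasi-transitively if some finite set of vertices
meets every `H`-orbit. -/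
def ActsQuasiTransitively {V : Type*} (G : SimpleGraph V) (H : Subgroup (G ≃g G)) : Prop :=
  ∃ W : Set V, W.Finite ∧ ∀ v : V, ∃ α ∈ H, ∃ w ∈ W, α v = w

/-- The function `h` on vertices is `H`-difference-invariant. -/
def IsDifferenceInvariant {V : Type*} (G : SimpleGraph V) (H : Subgroup (G ≃g G))
    (h : V → ℤ) : Prop :=
  ∀ v w : V, ∀ γ ∈ H, h v - h w = h (γ v) - h (γ w)

/-- The pair `(h, H)` is a graph height function on the graph `G` with origin `o`. -/
structure IsGraphHeightFunction {V : Type*} (G : SimpleGraph V) (o : V)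
    (h : V → ℤ) (H : Subgroup (G ≃g G)) : Prop where
  quasiTransitive : ActsQuasiTransitively G H
  map_origin : h o = 0
  differenceInvariant : IsDifferenceInvariant G H h
  exists_lt_lt : ∀ v : V, ∃ u w : V, G.Adj v u ∧ G.Adj v w ∧ h u < h v ∧ h v < h w

/-- The function `h` is a group height function on `Γ` with respect to the
generating set `S`. -/
structure IsGroupHeightFunction {Γ : Type*} [Group Γ] (S : Set Γ) (h : Γ → ℤ) : Prop where
  map_one : h 1 = 0
  ne_zero : ∃ γ : Γ, h γ ≠ 0
  map_prod : ∀ l : List Γ, (∀ s ∈ l, s ∈ S) → h l.prod = (l.map h).sum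
  sum_eq_zero : ∀ l : List Γ, (∀ s ∈ l, s ∈ S) → l.prod = 1 → (l.map h).sum = 0

/-! ### The Higman group and its Cayley graph -/

namespace Higman

/-- The four relators `sᵢ⁻¹ sᵢ₊₁ sᵢ = sᵢ₊₁²`, with indices modulo `4`;
the generators `a, b, c, d` are `s₀, s₁, s₂, s₃`. -/
def relators : Set (FreeGroup (Fin 4)) :=
  Set.range fun i : Fin 4 =>
    (FreeGroup.of i)⁻¹ * FreeGroup.of (i + 1) * FreeGroup.of i * (FreeGroup.of (i + 1) ^ 2)⁻¹

/-- The Higman group. -/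
abbrev HigmanGroup : Type := PresentedGroup relators

/-- The generators `a, b, c, d` of the Higman group. -/
def gen (i : Fin 4) : HigmanGroup := PresentedGroup.of i

/-- The symmetric generating set `{a, b, c, d, a⁻¹, b⁻¹, c⁻¹, d⁻¹}`. -/
def generators : Set HigmanGroup :=
  {x | ∃ i : Fin 4, x = gen i ∨ x = (gen i)⁻¹}

/-- The Cayley graph of the Higman group: `γ₁` and `γ₂` are adjacent when `γ₂ = γ₁ s`
with `s` in the symmetric generating set. -/
def cayleyGraph : SimpleGraph HigmanGroup := SimpleGraph.mulCayley generators

theorem gen_rel (i : Fin 4) :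
    (gen i)⁻¹ * gen (i + 1) * gen i * (gen (i + 1) ^ 2)⁻¹ = 1 :=
  PresentedGroup.one_of_mem (rels := relators) ⟨i, rfl⟩

/-- The endomorphism of the Higman group with `sᵢ ↦ sᵢ₊ₖ`. -/
def rotationHom (k : Fin 4) : HigmanGroup →* HigmanGroup :=
  PresentedGroup.toGroup (f := fun i => gen (i + k)) (by
    rintro _ ⟨i, rfl⟩
    have h := gen_rel (i + k)
    rw [add_right_comm] at h
    simpa using h)

theorem rotationHom_gen (k i : Fin 4) : rotationHom k (gen i) = gen (i + k) :=
  PresentedGroup.toGroup.of _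

theorem rotationHom_comp (k l : Fin 4) (h : k + l = 0) :
    (rotationHom l).comp (rotationHom k) = MonoidHom.id HigmanGroup := by
  apply PresentedGroup.ext
  intro i
  change rotationHom l (rotationHom k (gen i)) = gen i
  rw [rotationHom_gen, rotationHom_gen, add_assoc, h, add_zero]

/-- The group automorphism induced by the permutation `(a b c d)` of the generators. -/
def rotationEquiv : HigmanGroup ≃* HigmanGroup :=
  MonoidHom.toMulEquiv (rotationHom 1) (rotationHom 3)
    (rotationHom_comp 1 3 rfl) (rotationHom_comp 3 1 rfl)

theorem rotationHom_mem (k : Fin 4) {x : HigmanGroup} (hx : x ∈ generators) :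
    rotationHom k x ∈ generators := by
  obtain ⟨i, rfl | rfl⟩ := hx
  · exact ⟨i + k, Or.inl (rotationHom_gen k i)⟩
  · exact ⟨i + k, Or.inr (by rw [map_inv, rotationHom_gen])⟩

theorem rotationEquiv_mem_iff (x : HigmanGroup) :
    rotationEquiv x ∈ generators ↔ x ∈ generators := by
  refine ⟨fun h => ?_, fun h => rotationHom_mem 1 h⟩
  have h' := rotationHom_mem 3 h
  have e : rotationHom 3 (rotationEquiv x) = x := rotationEquiv.symm_apply_apply x
  rwa [e] at h'

/-- The automorphism of the Cayley graph induced by the permutation `(a b c d)` of the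
generators. -/
def rotation : cayleyGraph ≃g cayleyGraph where
  toEquiv := rotationEquiv.toEquiv
  map_rel_iff' := by
    intro u v
    change cayleyGraph.Adj (rotationEquiv u) (rotationEquiv v) ↔ cayleyGraph.Adj u v
    simp only [cayleyGraph, SimpleGraph.mulCayley_adj, ← map_inv, ← map_mul,
      rotationEquiv_mem_iff, ne_eq, EmbeddingLike.apply_eq_iff_eq]

end Higman

/-! Every automorphism of the Cayley graph is a rotation of the generators followed by a left
translation (`exists_eq_mul_rotationHom`); everything about height functions follows from this and
from the lack of finite quotients.

To prove rigidity one must know which words of length five are trivial. The group is therefore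
mapped to an explicit amalgam. The maps `t ↦ t / 2` and `t ↦ t + 1` of ℚ satisfy one relator; two
copies of `Equiv.Perm ℚ` glued along a cyclic group receive `a, b, c`, with `⟨a, c⟩` free; two
copies of the result, glued along that free group, receive all four generators. Hence no generator
occurs exactly once in a trivial word, trivial words in `sᵢ, sᵢ₊₂` have even length, and trivial
words in `a, b` act trivially on ℚ. It follows that two distinct edges at a vertex lie consecutively
on a closed walk of length five exactly when their indices do not differ by 2. Automorphisms
preserve this relation, hence inverse pairs of labels, and the shape of the relator then fixes the
signs and the cyclic order.

In a finite quotient the orders of the generators satisfy `nᵢ₊₁ ∣ 2 ^ nᵢ - 1` cyclically, which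
forces them all to be 1. A quasi-transitive `H` meets the left translations in a subgroup of finite
index, hence contains them all. A graph height function is then a homomorphism to ℤ, which vanishes
because the abelianisation is trivial. -/

/-! ### A concrete amalgam receiving the Higman group -/

namespace Higman

open Monoid

/-- The dilation `t ↦ t / 2` of the rational line. -/
def dilation : Equiv.Perm ℚ := Equiv.mulLeft₀ (1 / 2) (by norm_num)

/-- The translation `t ↦ t + 1` of the rational line. -/
def translation : Equiv.Perm ℚ := Equiv.addRight 1

theorem dilation_apply (t : ℚ) : dilation t = 1 / 2 * t := rfl

theorem dilation_inv_apply (t : ℚ) : dilation⁻¹ t = 2 * t := by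
  rw [Equiv.Perm.inv_eq_iff_eq, dilation_apply]
  ring

theorem translation_apply (t : ℚ) : translation t = t + 1 := rfl

theorem translation_inv_apply (t : ℚ) : translation⁻¹ t = t - 1 := by
  rw [Equiv.Perm.inv_eq_iff_eq, translation_apply]
  ring

theorem dilation_translation_rel :
    dilation⁻¹ * translation * dilation * (translation ^ 2)⁻¹ = 1 := by
  rw [mul_inv_eq_one]
  ext t
  simp only [Equiv.Perm.mul_apply, pow_two, dilation_apply, dilation_inv_apply, translation_apply]
  ring

theorem dilation_zpow_apply (n : ℤ) (t : ℚ) : (dilation ^ n) t = (1 / 2) ^ n * t := by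
  induction n generalizing t with
  | zero => simp
  | succ n ih =>
    rw [zpow_add_one, Equiv.Perm.mul_apply, ih, dilation_apply, zpow_add_one₀ (by norm_num)]
    ring
  | pred n ih =>
    rw [zpow_sub_one, Equiv.Perm.mul_apply, ih, dilation_inv_apply, zpow_sub_one₀ (by norm_num)]
    ring

theorem translation_zpow_apply (n : ℤ) (t : ℚ) : (translation ^ n) t = t + n := by
  induction n generalizing t with
  | zero => simp
  | succ n ih =>
    rw [zpow_add_one, Equiv.Perm.mul_apply, ih, translation_apply]
    push_cast
    ring
  | pred n ih =>
    rw [zpow_sub_one, Equiv.Perm.mul_apply, ih, translation_inv_apply]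
    push_cast
    ring

theorem zpow_eq_zero_of_dilation_zpow_eq_translation_zpow {m n : ℤ}
    (h : dilation ^ m = translation ^ n) : m = 0 ∧ n = 0 := by
  have h0 := Equiv.congr_fun h 0
  have h1 := Equiv.congr_fun h 1
  rw [dilation_zpow_apply, translation_zpow_apply] at h0 h1
  have hn : n = 0 := by
    have : (n : ℚ) = 0 := by linarith
    exact_mod_cast this
  subst hn
  refine ⟨?_, rfl⟩
  have h2 : (1 / 2 : ℚ) ^ m = (1 / 2) ^ (0 : ℤ) := by
    rw [zpow_zero]
    simpa using h1
  exact zpow_right_injective₀ (by norm_num) (by norm_num) h2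

/-- The element of the `i`-th affine factor generating the amalgamated cyclic subgroup. -/
def inner (i : Fin 2) : Equiv.Perm ℚ := ![translation, dilation] i

/-- The element of the `i`-th affine factor complementary to `inner i`. -/
def outer (i : Fin 2) : Equiv.Perm ℚ := ![dilation, translation] i

theorem zpow_eq_zero_of_outer_zpow_eq_inner_zpow {i : Fin 2} {m n : ℤ}
    (h : outer i ^ m = inner i ^ n) : m = 0 ∧ n = 0 := by
  fin_cases i
  · exact zpow_eq_zero_of_dilation_zpow_eq_translation_zpow h
  · exact (zpow_eq_zero_of_dilation_zpow_eq_translation_zpow h.symm).symm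

/-- The embeddings of the infinite cyclic group along which two affine groups are amalgamated. -/
def innerHom (i : Fin 2) : Multiplicative ℤ →* Equiv.Perm ℚ := zpowersHom _ (inner i)

/-- The infinite cyclic subgroups of the affine groups complementary to the amalgamated one. -/
def outerHom (i : Fin 2) : Multiplicative ℤ →* Equiv.Perm ℚ := zpowersHom _ (outer i)

theorem innerHom_injective (i : Fin 2) : Function.Injective (innerHom i) := by
  rw [injective_iff_map_eq_one]
  intro n hn
  have : outer i ^ (0 : ℤ) = inner i ^ n.toAdd := by
    rw [zpow_zero]
    exact hn.symm
  exact (zpow_eq_zero_of_outer_zpow_eq_inner_zpow this).2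

theorem outerHom_notMem_range {i : Fin 2} {n : Multiplicative ℤ} (hn : n ≠ 1) :
    outerHom i n ∉ (innerHom i).range := by
  rintro ⟨m, hm⟩
  have : outer i ^ n.toAdd = inner i ^ m.toAdd := hm.symm
  exact hn (zpow_eq_zero_of_outer_zpow_eq_inner_zpow this).1

/-- The amalgam of two affine groups in which `⟨a, b, c⟩` is represented: the translation of the
first factor is identified with the dilation of the second. -/
abbrev TripleModel : Type := PushoutI innerHom

/-- The inclusions of the two affine factors. -/
abbrev tripleOf (i : Fin 2) : Equiv.Perm ℚ →* TripleModel :=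
  PushoutI.of (G := fun _ : Fin 2 => Equiv.Perm ℚ) i

/-! ### The free subgroup `⟨a, c⟩` and the second amalgam -/

/-- The free group of rank two, as a free product. -/
abbrev FreeRankTwo : Type := CoprodI fun _ : Fin 2 => Multiplicative ℤ

/-- The inclusions of the two infinite cyclic factors. -/
abbrev freeOf (i : Fin 2) : Multiplicative ℤ →* FreeRankTwo :=
  CoprodI.of (M := fun _ : Fin 2 => Multiplicative ℤ) (i := i)

/-- The homomorphism from the free group of rank two onto the subgroup `⟨a, c⟩`. -/
def outerFreeHom : FreeRankTwo →* TripleModel :=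
  CoprodI.lift fun i => (tripleOf i).comp (outerHom i)

/-- Nontrivial powers of the outer elements avoid the amalgamated subgroup, so a reduced word of the
free product stays reduced in the amalgam. By the normal form theorem only the empty reduced word
lands in the base. -/
theorem eq_one_of_outerFreeHom_mem_base {x : FreeRankTwo}
    (hx : outerFreeHom x ∈ (PushoutI.base innerHom).range) : x = 1 := by
  obtain ⟨w, rfl⟩ := (CoprodI.Word.equiv (M := fun _ : Fin 2 => Multiplicative ℤ)).symm.surjective x
  change outerFreeHom w.prod ∈ _ at hx
  change w.prod = 1
  let w' : CoprodI.Word fun _ : Fin 2 => Equiv.Perm ℚ :=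
    { toList := w.toList.map fun g => ⟨g.1, outerHom g.1 g.2⟩
      ne_one := by
        intro l hl
        obtain ⟨g, hg, rfl⟩ := List.mem_map.1 hl
        intro h
        exact outerHom_notMem_range (w.ne_one g hg) (h ▸ one_mem _)
      chain_ne := by
        rw [List.isChain_map]
        exact w.chain_ne }
  have hred : PushoutI.Reduced innerHom w' := by
    intro l hl
    obtain ⟨g, hg, rfl⟩ := List.mem_map.1 hl
    exact outerHom_notMem_range (w.ne_one g hg)
  have hprod : PushoutI.ofCoprodI w'.prod = outerFreeHom w.prod := by
    simp only [CoprodI.Word.prod, map_list_prod, w', List.map_map]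
    congr 1
  have hempty := hred.eq_empty_of_mem_range innerHom_injective (by rwa [hprod])
  have hlist : w.toList = [] := by
    have := congrArg CoprodI.Word.toList hempty
    simpa [w', CoprodI.Word.empty] using this
  simp [CoprodI.Word.prod, hlist]

theorem outerFreeHom_injective : Function.Injective outerFreeHom := by
  rw [injective_iff_map_eq_one]
  intro x hx
  exact eq_one_of_outerFreeHom_mem_base (hx ▸ one_mem _)

theorem of_translation_notMem_range :
    tripleOf 0 translation ∉ outerFreeHom.range := by
  rintro ⟨x, hx⟩
  have hb : tripleOf 0 translation =
      PushoutI.base innerHom (Multiplicative.ofAdd 1) := by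
    rw [← PushoutI.of_apply_eq_base innerHom 0]
    simp [innerHom, inner]
  have h1 : x = 1 := eq_one_of_outerFreeHom_mem_base ⟨_, (hx.trans hb).symm⟩
  rw [h1, map_one, hb, eq_comm,
    map_eq_one_iff _ (PushoutI.base_injective innerHom_injective)] at hx
  exact absurd (congrArg Multiplicative.toAdd hx) one_ne_zero

/-- The endomorphism of the free group of rank two shifting the two generators by `i`. -/
def freeShift (i : Fin 2) : FreeRankTwo →* FreeRankTwo :=
  CoprodI.lift fun j => freeOf (j + i)

theorem freeShift_freeShift (i : Fin 2) (x : FreeRankTwo) : freeShift i (freeShift i x) = x := by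
  have : (freeShift i).comp (freeShift i) = MonoidHom.id _ := by
    apply CoprodI.ext_hom
    intro j
    ext
    fin_cases i <;> fin_cases j <;> simp [freeShift]
  exact DFunLike.congr_fun this x

/-- The two embeddings of the free group of rank two along which two copies of `TripleModel`
are amalgamated. -/
def amalgamHom (i : Fin 2) : FreeRankTwo →* TripleModel := outerFreeHom.comp (freeShift i)

theorem amalgamHom_injective (i : Fin 2) : Function.Injective (amalgamHom i) :=
  outerFreeHom_injective.comp (Function.LeftInverse.injective (freeShift_freeShift i))

/-- An amalgam of two copies of `TripleModel`, in which the Higman group is represented. -/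
abbrev Model : Type := PushoutI amalgamHom

/-- The inclusions of the two copies of `TripleModel`. -/
abbrev modelOf (i : Fin 2) : TripleModel →* Model :=
  PushoutI.of (G := fun _ : Fin 2 => TripleModel) i

/-- The images of the generators of the Higman group in `Model`. -/
def modelGen : Fin 4 → Model :=
  ![modelOf 0 (tripleOf 0 dilation), modelOf 0 (tripleOf 0 translation),
    modelOf 1 (tripleOf 0 dilation), modelOf 1 (tripleOf 0 translation)]

/-- The two free generators of `FreeRankTwo`. -/
def freeGen (i : Fin 2) : FreeRankTwo := freeOf i (Multiplicative.ofAdd 1)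

theorem base_freeGen_zero : PushoutI.base amalgamHom (freeGen 0) = modelGen 0 := by
  rw [← PushoutI.of_apply_eq_base amalgamHom 0]
  simp [amalgamHom, freeShift, outerFreeHom, outerHom, outer, modelGen, freeGen]

theorem base_freeGen_one : PushoutI.base amalgamHom (freeGen 1) = modelGen 2 := by
  rw [← PushoutI.of_apply_eq_base amalgamHom 1]
  simp [amalgamHom, freeShift, outerFreeHom, outerHom, outer, modelGen, freeGen]

theorem modelGen_zero_eq : modelGen 0 = modelOf 1 (tripleOf 1 translation) := by
  rw [← base_freeGen_zero, ← PushoutI.of_apply_eq_base amalgamHom 1]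
  simp [amalgamHom, freeShift, outerFreeHom, outerHom, outer, freeGen]

theorem modelGen_two_eq : modelGen 2 = modelOf 0 (tripleOf 1 translation) := by
  rw [← base_freeGen_one, ← PushoutI.of_apply_eq_base amalgamHom 0]
  simp [amalgamHom, freeShift, outerFreeHom, outerHom, outer, freeGen]

theorem of_translation_eq_of_dilation :
    tripleOf 0 translation = PushoutI.of 1 dilation := by
  have h0 := PushoutI.of_apply_eq_base innerHom 0 (Multiplicative.ofAdd 1)
  have h1 := PushoutI.of_apply_eq_base innerHom 1 (Multiplicative.ofAdd 1)
  simpa [innerHom, inner] using h0.trans h1.symm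

theorem modelGen_rel (i : Fin 4) :
    (modelGen i)⁻¹ * modelGen (i + 1) * modelGen i * (modelGen (i + 1) ^ 2)⁻¹ = 1 := by
  have key (j k : Fin 2) (x y : Model)
      (hx : x = modelOf j (tripleOf k dilation))
      (hy : y = modelOf j (tripleOf k translation)) :
      x⁻¹ * y * x * (y ^ 2)⁻¹ = 1 := by
    rw [hx, hy]
    simp only [← map_inv, ← map_mul, ← map_pow, dilation_translation_rel, map_one]
  fin_cases i
  · exact key 0 0 _ _ rfl rfl
  · exact key 0 1 _ _ (congrArg (modelOf _) of_translation_eq_of_dilation) modelGen_two_eq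
  · exact key 1 0 _ _ rfl rfl
  · exact key 1 1 _ _ (congrArg (modelOf _) of_translation_eq_of_dilation) modelGen_zero_eq

/-- The representation of the Higman group in the concrete amalgam. -/
def toModel : HigmanGroup →* Model :=
  PresentedGroup.toGroup (f := modelGen) (by
    rintro _ ⟨i, rfl⟩
    simpa using modelGen_rel i)

theorem toModel_gen (i : Fin 4) : toModel (gen i) = modelGen i :=
  PresentedGroup.toGroup.of _

theorem modelGen_mem_range_of_ne {i : Fin 4} (hi : i ≠ 3) :
    modelGen i ∈ (modelOf 0).range := by
  fin_cases i
  · exact ⟨_, rfl⟩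
  · exact ⟨_, rfl⟩
  · exact ⟨_, modelGen_two_eq.symm⟩
  · exact absurd rfl hi

/-- The two factors of an amalgam meet only in the base. In the second copy `d` is the first
translation, which is not in the free subgroup being amalgamated. -/
theorem modelGen_three_notMem_range :
    modelGen 3 ∉ (modelOf 0).range := by
  intro h
  have hmem : modelGen 3 ∈ (PushoutI.base amalgamHom).range := by
    rw [← PushoutI.inf_of_range_eq_base_range amalgamHom_injective (zero_ne_one (α := Fin 2))]
    exact ⟨h, _, rfl⟩
  obtain ⟨x, hx⟩ := hmem
  rw [← PushoutI.of_apply_eq_base amalgamHom 1] at hx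
  exact of_translation_notMem_range
    ⟨_, PushoutI.of_injective amalgamHom_injective 1 hx⟩

theorem gen_three_notMem_closure :
    gen 3 ∉ Subgroup.closure {x | ∃ i : Fin 4, i ≠ 3 ∧ x = gen i} := by
  intro h
  refine modelGen_three_notMem_range ?_
  rw [← toModel_gen]
  have hle : Subgroup.closure {x | ∃ i : Fin 4, i ≠ 3 ∧ x = gen i} ≤
      Subgroup.comap (N := Model) toModel (modelOf 0).range := by
    rw [Subgroup.closure_le]
    rintro _ ⟨i, hi, rfl⟩
    change toModel (gen i) ∈ (modelOf 0).range
    rw [toModel_gen]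
    exact modelGen_mem_range_of_ne hi
  exact hle h

end Higman


namespace Higman

open Monoid

/-! ### Short words in the generators -/

/-- The element of the symmetric generating set with a given index and sign. -/
def letter (s : Fin 4 × Bool) : HigmanGroup := if s.2 then gen s.1 else (gen s.1)⁻¹

/-- The index-sign pair of the inverse letter. -/
def flip (s : Fin 4 × Bool) : Fin 4 × Bool := (s.1, !s.2)

theorem letter_true (i : Fin 4) : letter (i, true) = gen i := rfl

theorem letter_false (i : Fin 4) : letter (i, false) = (gen i)⁻¹ := rfl

theorem letter_flip (s : Fin 4 × Bool) : letter (flip s) = (letter s)⁻¹ := by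
  obtain ⟨i, _ | _⟩ := s <;> simp [letter, flip]

theorem flip_flip (s : Fin 4 × Bool) : flip (flip s) = s := by
  simp [flip]

theorem eq_flip_of_fst_eq {s t : Fin 4 × Bool} (h : s.1 = t.1) (hne : s ≠ t) : s = flip t := by
  obtain ⟨i, _ | _⟩ := s <;> obtain ⟨j, _ | _⟩ := t <;> simp_all [flip]

theorem mem_generators_iff (x : HigmanGroup) : x ∈ generators ↔ ∃ s, x = letter s := by
  constructor
  · rintro ⟨i, rfl | rfl⟩
    · exact ⟨(i, true), rfl⟩
    · exact ⟨(i, false), rfl⟩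
  · rintro ⟨⟨i, _ | _⟩, rfl⟩
    · exact ⟨i, Or.inr rfl⟩
    · exact ⟨i, Or.inl rfl⟩

theorem rotationHom_letter (k : Fin 4) (s : Fin 4 × Bool) :
    rotationHom k (letter s) = letter (s.1 + k, s.2) := by
  obtain ⟨i, _ | _⟩ := s <;> simp [letter, rotationHom_gen]

theorem prod_letter_shift (k : Fin 4) {l : List (Fin 4 × Bool)} (h : (l.map letter).prod = 1) :
    ((l.map fun s => (s.1 + k, s.2)).map letter).prod = 1 := by
  have := congrArg (rotationHom k) h
  rw [map_list_prod, map_one, List.map_map] at this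
  rw [List.map_map, ← this]
  congr 2
  funext s
  exact (rotationHom_letter k s).symm

theorem prod_letter_mem_closure {l : List (Fin 4 × Bool)} (h : 3 ∉ l.map Prod.fst) :
    (l.map letter).prod ∈ Subgroup.closure {x | ∃ i : Fin 4, i ≠ 3 ∧ x = gen i} := by
  apply Subgroup.list_prod_mem
  intro x hx
  obtain ⟨⟨i, ε⟩, hs, rfl⟩ := List.mem_map.1 hx
  have hi : i ≠ 3 := by
    rintro rfl
    exact h (List.mem_map.2 ⟨_, hs, rfl⟩)
  have hmem := Subgroup.subset_closure (k := {x | ∃ i : Fin 4, i ≠ 3 ∧ x = gen i}) ⟨i, hi, rfl⟩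
  cases ε
  · exact inv_mem hmem
  · exact hmem

/-- In a word representing the identity, no generator occurs exactly once. -/
theorem count_ne_one_of_prod_letter_eq_one {l : List (Fin 4 × Bool)}
    (h : (l.map letter).prod = 1) (i : Fin 4) : (l.map Prod.fst).count i ≠ 1 := by
  have key : ∀ l : List (Fin 4 × Bool), (l.map letter).prod = 1 →
      (l.map Prod.fst).count 3 ≠ 1 := by
    intro l h hc
    have hmem : 3 ∈ l.map Prod.fst := by
      rw [← List.count_pos_iff, hc]
      exact one_pos
    obtain ⟨⟨j, ε⟩, hs, hj⟩ := List.mem_map.1 hmem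
    obtain rfl : j = 3 := hj
    obtain ⟨l₁, l₂, rfl⟩ := List.append_of_mem hs
    simp only [List.map_append, List.map_cons, List.count_append, List.count_cons_self] at hc
    have h₁ : 3 ∉ l₁.map Prod.fst := List.count_eq_zero.1 (by omega)
    have h₂ : 3 ∉ l₂.map Prod.fst := List.count_eq_zero.1 (by omega)
    -- Solve the relation for the single occurrence of `d`, which then lies in `⟨a, b, c⟩`.
    rw [List.map_append, List.map_cons, List.prod_append, List.prod_cons, mul_eq_one_iff_inv_eq,
      ← mul_inv_eq_iff_eq_mul, eq_comm] at h
    have hlet : letter (3, ε) ∈ Subgroup.closure {x | ∃ i : Fin 4, i ≠ 3 ∧ x = gen i} := by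
      rw [h]
      exact mul_mem (inv_mem (prod_letter_mem_closure h₁)) (inv_mem (prod_letter_mem_closure h₂))
    apply gen_three_notMem_closure
    cases ε
    · exact inv_mem_iff.1 hlet
    · exact hlet
  have h3 := key _ (prod_letter_shift (3 - i) h)
  rw [List.map_map] at h3
  have hmap : (l.map (Prod.fst ∘ fun s : Fin 4 × Bool => (s.1 + (3 - i), s.2))) =
      (l.map Prod.fst).map (· + (3 - i)) := by
    rw [List.map_map]
    rfl
  have hcount := List.count_map_of_injective (l.map Prod.fst) (· + (3 - i))
    (add_left_injective _) i
  rw [hmap] at h3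
  rw [← hcount]
  simpa using h3

/-- The parity of the word length on the free group of rank two. -/
def freeParity : FreeRankTwo →* Multiplicative (ZMod 2) :=
  CoprodI.lift fun _ => (Int.castAddHom (ZMod 2)).toMultiplicative

/-- A word in `sᵢ, sᵢ₊₂` representing the identity has even length. -/
theorem even_length_of_prod_letter_eq_one {l : List (Fin 4 × Bool)} (i : Fin 4)
    (hl : ∀ s ∈ l, s.1 = i ∨ s.1 = i + 2) (h : (l.map letter).prod = 1) : Even l.length := by
  -- Words in `a, c` lift to the amalgamated free group, which embeds in `Model`; there length
  -- parity is a homomorphism.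
  have key : ∀ l : List (Fin 4 × Bool), (∀ s ∈ l, s.1 = 0 ∨ s.1 = 2) → ∃ x : FreeRankTwo,
      PushoutI.base amalgamHom x = toModel (l.map letter).prod ∧
        freeParity x = Multiplicative.ofAdd (l.length : ZMod 2) := by
    intro l
    induction l with
    | nil =>
      intro _
      exact ⟨1, by simp, by simp⟩
    | cons s l ih =>
      intro hl
      obtain ⟨x, hx, hp⟩ := ih fun t ht => hl t (List.mem_cons_of_mem _ ht)
      suffices hs : ∃ y : FreeRankTwo, PushoutI.base amalgamHom y = toModel (letter s) ∧
          freeParity y = Multiplicative.ofAdd 1 by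
        obtain ⟨y, hy, hq⟩ := hs
        refine ⟨y * x, ?_, ?_⟩
        · rw [map_mul, hy, hx, List.map_cons, List.prod_cons, map_mul]
        · rw [map_mul, hq, hp, List.length_cons, Nat.cast_add, Nat.cast_one, add_comm, ofAdd_add]
      obtain ⟨j, ε⟩ := s
      have hodd (k : Fin 2) : freeParity (freeGen k) = Multiplicative.ofAdd 1 := by
        simp [freeParity, freeGen]
      have hodd' (k : Fin 2) : freeParity (freeGen k)⁻¹ = Multiplicative.ofAdd 1 := by
        rw [map_inv, hodd]
        rfl
      have hj : ∃ k : Fin 2, PushoutI.base amalgamHom (freeGen k) = toModel (gen j) := by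
        rcases hl _ List.mem_cons_self with hj | hj <;> obtain rfl := hj
        · exact ⟨0, by rw [toModel_gen, base_freeGen_zero]⟩
        · exact ⟨1, by rw [toModel_gen, base_freeGen_one]⟩
      obtain ⟨k, hk⟩ := hj
      cases ε
      · exact ⟨_, by rw [map_inv, hk, letter_false, map_inv], hodd' k⟩
      · exact ⟨_, hk, hodd k⟩
  obtain ⟨x, hx, hp⟩ := key (l.map fun s => (s.1 + -i, s.2)) (by
    intro s hs
    obtain ⟨t, ht, rfl⟩ := List.mem_map.1 hs
    rcases hl t ht with h | h
    · left
      simp [h]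
    · right
      simp [h])
  rw [prod_letter_shift _ h, map_one,
    map_eq_one_iff _ (PushoutI.base_injective amalgamHom_injective)] at hx
  rw [hx, map_one, List.length_map] at hp
  exact (ZMod.natCast_eq_zero_iff_even).1 (congrArg Multiplicative.toAdd hp).symm

/-- The affine map representing a letter of `⟨a, b⟩`. -/
def affineLetter (s : Fin 4 × Bool) : Equiv.Perm ℚ :=
  if s.1 = 0 then (if s.2 then dilation else dilation⁻¹)
  else (if s.2 then translation else translation⁻¹)

/-- A word in `a, b` representing the identity acts trivially on the rational line. -/
theorem affine_eq_one_of_prod_letter_eq_one {l : List (Fin 4 × Bool)}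
    (hl : ∀ s ∈ l, s.1 = 0 ∨ s.1 = 1) (h : (l.map letter).prod = 1) :
    (l.map affineLetter).prod = 1 := by
  have key : ∀ s ∈ l, toModel (letter s) = modelOf 0 (tripleOf 0 (affineLetter s)) := by
    rintro ⟨j, ε⟩ hs
    rcases hl _ hs with hj | hj <;> obtain rfl := hj <;> cases ε <;>
      simp [letter, affineLetter, toModel_gen, modelGen]
  have hprod : modelOf 0 (tripleOf 0 (l.map affineLetter).prod) = 1 := by
    rw [map_list_prod, map_list_prod, List.map_map, List.map_map, ← map_one toModel, ← h,
      map_list_prod, List.map_map]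
    congr 1
    exact List.map_congr_left fun s hs => (key s hs).symm
  rwa [map_eq_one_iff _ (PushoutI.of_injective amalgamHom_injective 0),
    map_eq_one_iff _ (PushoutI.of_injective innerHom_injective 0)] at hprod

/-- The action of `affineLetter s` on the rational line. -/
def affineAct (s : Fin 4 × Bool) (t : ℚ) : ℚ :=
  if s.1 = 0 then (if s.2 then t / 2 else 2 * t) else (if s.2 then t + 1 else t - 1)

theorem affineLetter_apply (s : Fin 4 × Bool) (t : ℚ) : affineLetter s t = affineAct s t := by
  unfold affineLetter affineAct
  split_ifs
  · rw [dilation_apply]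
    ring
  · rw [dilation_inv_apply]
  · rw [translation_apply]
  · rw [translation_inv_apply]

theorem letter_injective : Function.Injective letter := by
  intro s t h
  by_contra hne
  have hprod : ([s, flip t].map letter).prod = 1 := by
    simp [letter_flip, h]
  by_cases hst : s.1 = t.1
  · rw [← eq_flip_of_fst_eq hst hne] at hprod
    have := affine_eq_one_of_prod_letter_eq_one (by simp) (prod_letter_shift (-s.1) hprod)
    have h1 := Equiv.congr_fun this 1
    simp only [List.map_cons, List.map_nil, List.prod_cons, List.prod_nil, mul_one,
      Equiv.Perm.mul_apply, affineLetter_apply, Equiv.Perm.one_apply] at h1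
    unfold affineAct at h1
    cases hs : s.2 <;> simp [hs] at h1 <;> norm_num at h1
  · refine count_ne_one_of_prod_letter_eq_one hprod s.1 ?_
    simp [flip, Ne.symm hst]

/-- A closed walk of length five does not turn from `sᵢ` to `sᵢ₊₂`. -/
theorem prod_letter_ne_one_of_opposite {s t : Fin 4 × Bool} (hst : t.1 = s.1 + 2)
    (x y z : Fin 4 × Bool) : ([s, t, x, y, z].map letter).prod ≠ 1 := by
  intro h
  have hc := count_ne_one_of_prod_letter_eq_one h
  simp only [List.map_cons, List.map_nil, hst] at hc
  -- Both `i` and `i + 2` must recur among the last three indices; the one left over cannot be a new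
  -- index occurring once.
  have key : ∀ i p q r : Fin 4, (∀ j, List.count j [i, i + 2, p, q, r] ≠ 1) →
      (p = i ∨ p = i + 2) ∧ (q = i ∨ q = i + 2) ∧ (r = i ∨ r = i + 2) := by
    decide
  have := key _ _ _ _ hc
  have heven := even_length_of_prod_letter_eq_one s.1 (by simp [hst, this]) h
  exact absurd heven (show ¬ Even 5 by decide)

theorem eq_of_affineAct_translation_sq (ε : Bool) (x y z : Fin 4 × Bool)
    (hx : x.1 = 0 ∨ x.1 = 1) (hy : y.1 = 0 ∨ y.1 = 1) (hz : z.1 = 0 ∨ z.1 = 1)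
    (h : ∀ t, affineAct (1, ε) (affineAct (1, ε) (affineAct x (affineAct y (affineAct z t)))) = t) :
    x = (0, false) ∧ y = (1, !ε) ∧ z = (0, true) := by
  -- An affine map is determined by its values at 0 and 1, so what remains is a finite check.
  have h0 := h 0
  have h1 := h 1
  clear h
  revert ε x y z
  decide +kernel

theorem affineAct_dilation_sq_ne (ε : Bool) (x y z : Fin 4 × Bool)
    (hx : x.1 = 0 ∨ x.1 = 1) (hy : y.1 = 0 ∨ y.1 = 1) (hz : z.1 = 0 ∨ z.1 = 1) :
    ¬ ∀ t, affineAct (0, ε) (affineAct (0, ε) (affineAct x (affineAct y (affineAct z t)))) = t := by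
  intro h
  have h0 := h 0
  have h1 := h 1
  clear h
  revert ε x y z
  decide +kernel

theorem affineAct_eq_of_prod_letter_eq_one {s₁ s₂ s₃ s₄ s₅ : Fin 4 × Bool}
    (hl : ∀ s ∈ [s₁, s₂, s₃, s₄, s₅], s.1 = 0 ∨ s.1 = 1)
    (h : ([s₁, s₂, s₃, s₄, s₅].map letter).prod = 1) (t : ℚ) :
    affineAct s₁ (affineAct s₂ (affineAct s₃ (affineAct s₄ (affineAct s₅ t)))) = t := by
  have := Equiv.congr_fun (affine_eq_one_of_prod_letter_eq_one hl h) t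
  simpa only [List.map_cons, List.map_nil, List.prod_cons, List.prod_nil, mul_one,
    Equiv.Perm.mul_apply, affineLetter_apply, Equiv.Perm.one_apply] using this

/-- A closed walk of length five repeating a letter is the defining relator. -/
theorem eq_relator_of_prod_letter_eq_one {s x y z : Fin 4 × Bool}
    (h : ([s, s, x, y, z].map letter).prod = 1) :
    x = (s.1 - 1, false) ∧ y = flip s ∧ z = (s.1 - 1, true) := by
  have hc := count_ne_one_of_prod_letter_eq_one h
  simp only [List.map_cons, List.map_nil] at hc
  -- At most one further index `j` occurs. The cases `j = i + 2`, `j = i + 1`, `j = i - 1` are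
  -- settled by parity, by `s` acting as a dilation, and by `s` acting as a translation; only the
  -- last one survives.
  have key : ∀ i p q r : Fin 4, (∀ j, List.count j [i, i, p, q, r] ≠ 1) →
      ((p = i ∨ p = i + 2) ∧ (q = i ∨ q = i + 2) ∧ (r = i ∨ r = i + 2)) ∨
      ((p + -i = 0 ∨ p + -i = 1) ∧ (q + -i = 0 ∨ q + -i = 1) ∧ (r + -i = 0 ∨ r + -i = 1)) ∨
      ((p + (1 - i) = 0 ∨ p + (1 - i) = 1) ∧ (q + (1 - i) = 0 ∨ q + (1 - i) = 1) ∧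
        (r + (1 - i) = 0 ∨ r + (1 - i) = 1)) := by
    decide
  rcases key _ _ _ _ hc with hpqr | ⟨hp, hq, hr⟩ | ⟨hp, hq, hr⟩
  · have heven := even_length_of_prod_letter_eq_one s.1 (by simp [hpqr]) h
    exact absurd heven (show ¬ Even 5 by decide)
  · have hs := prod_letter_shift (-s.1) h
    simp only [List.map_cons, List.map_nil, add_neg_cancel] at hs
    exact absurd (affineAct_eq_of_prod_letter_eq_one (by simp [hp, hq, hr]) hs)
      (affineAct_dilation_sq_ne s.2 _ _ _ hp hq hr)
  · have hs := prod_letter_shift (1 - s.1) h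
    simp only [List.map_cons, List.map_nil, add_sub_cancel] at hs
    obtain ⟨hx, hy, hz⟩ := eq_of_affineAct_translation_sq s.2 _ _ _ hp hq hr
      (affineAct_eq_of_prod_letter_eq_one (by simp [hp, hq, hr]) hs)
    have key : ∀ i p : Fin 4, (p + (1 - i) = 0 → p = i - 1) ∧ (p + (1 - i) = 1 → p = i) := by
      decide
    rw [Prod.ext_iff] at hx hy hz
    exact ⟨Prod.ext ((key _ _).1 hx.1) hx.2, Prod.ext ((key _ _).2 hy.1) hy.2,
      Prod.ext ((key _ _).1 hz.1) hz.2⟩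

end Higman


namespace Higman

/-! ### Automorphisms of the Cayley graph -/

theorem letter_ne_one (s : Fin 4 × Bool) : letter s ≠ 1 := by
  intro h
  have hs : ([s].map letter).prod = 1 := by simpa using h
  exact count_ne_one_of_prod_letter_eq_one hs s.1 (by simp)

theorem cayleyGraph_adj_iff (u v : HigmanGroup) :
    cayleyGraph.Adj u v ↔ ∃ s, v = u * letter s := by
  rw [cayleyGraph, SimpleGraph.mulCayley_adj']
  constructor
  · rintro ⟨-, g, hg, h⟩
    obtain ⟨s, rfl⟩ := (mem_generators_iff g).1 hg
    rcases h with h | h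
    · exact ⟨s, h.symm⟩
    · exact ⟨flip s, by rw [h, letter_flip, mul_inv_cancel_right]⟩
  · rintro ⟨s, rfl⟩
    refine ⟨fun h => letter_ne_one s (left_eq_mul.1 h), letter s,
      (mem_generators_iff _).2 ⟨s, rfl⟩, Or.inl rfl⟩

theorem exists_letter_map_mul (φ : cayleyGraph ≃g cayleyGraph) (v : HigmanGroup)
    (s : Fin 4 × Bool) : ∃ t, φ (v * letter s) = φ v * letter t :=
  (cayleyGraph_adj_iff _ _).1 (φ.map_adj_iff.2 ((cayleyGraph_adj_iff _ _).2 ⟨s, rfl⟩))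

/-- The action of a graph automorphism on the edges at the vertex `v`, in terms of their labels. -/
noncomputable def localLetter (φ : cayleyGraph ≃g cayleyGraph) (v : HigmanGroup)
    (s : Fin 4 × Bool) : Fin 4 × Bool :=
  (exists_letter_map_mul φ v s).choose

section LocalLetter

variable (φ : cayleyGraph ≃g cayleyGraph) (v : HigmanGroup)

theorem map_mul_letter (s : Fin 4 × Bool) :
    φ (v * letter s) = φ v * letter (localLetter φ v s) :=
  (exists_letter_map_mul φ v s).choose_spec

theorem localLetter_injective : Function.Injective (localLetter φ v) := by
  intro s t h
  have : φ (v * letter s) = φ (v * letter t) := by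
    rw [map_mul_letter, map_mul_letter, h]
  exact letter_injective (mul_left_cancel (φ.injective this))

theorem localLetter_symm_localLetter (s : Fin 4 × Bool) :
    localLetter φ.symm (φ v) (localLetter φ v s) = s := by
  have h := map_mul_letter φ.symm (φ v) (localLetter φ v s)
  rw [← map_mul_letter, φ.symm_apply_apply, φ.symm_apply_apply] at h
  exact (letter_injective (mul_left_cancel h)).symm

theorem localLetter_mul_letter_flip (s : Fin 4 × Bool) :
    localLetter φ (v * letter s) (flip s) = flip (localLetter φ v s) := by
  have h := map_mul_letter φ (v * letter s) (flip s)
  rw [letter_flip, mul_inv_cancel_right, map_mul_letter, mul_assoc, left_eq_mul,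
    mul_eq_one_iff_inv_eq, ← letter_flip] at h
  exact (letter_injective h).symm

/-- The labels along the image of the walk starting at `v` with labels `l`. -/
noncomputable def walkLetters : HigmanGroup → List (Fin 4 × Bool) → List (Fin 4 × Bool)
  | _, [] => []
  | v, s :: l => localLetter φ v s :: walkLetters (v * letter s) l

theorem map_mul_prod_letter (l : List (Fin 4 × Bool)) :
    φ (v * (l.map letter).prod) = φ v * ((walkLetters φ v l).map letter).prod := by
  induction l generalizing v with
  | nil => simp [walkLetters]
  | cons s l ih =>
    simp only [walkLetters, List.map_cons, List.prod_cons, ← mul_assoc, ih, map_mul_letter]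

theorem prod_walkLetters_eq_one {l : List (Fin 4 × Bool)} (h : (l.map letter).prod = 1) :
    ((walkLetters φ v l).map letter).prod = 1 := by
  have := map_mul_prod_letter φ v l
  rwa [h, mul_one, left_eq_mul] at this

end LocalLetter

/-! ### Corners of closed walks of length five -/

/-- The labels `s` and `t` leave a common vertex along a closed walk of length five. -/
def IsCorner (s t : Fin 4 × Bool) : Prop :=
  ∃ x y z, ([flip s, t, x, y, z].map letter).prod = 1

theorem IsCorner.map {s t : Fin 4 × Bool} (h : IsCorner s t) (φ : cayleyGraph ≃g cayleyGraph)
    (v : HigmanGroup) : IsCorner (localLetter φ v s) (localLetter φ v t) := by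
  obtain ⟨x, y, z, h⟩ := h
  have h := prod_walkLetters_eq_one φ (v * letter s) h
  simp only [walkLetters, localLetter_mul_letter_flip, letter_flip, mul_inv_cancel_right] at h
  exact ⟨_, _, _, h⟩

theorem IsCorner.fst_ne {s t : Fin 4 × Bool} (h : IsCorner s t) : t.1 ≠ s.1 + 2 := by
  obtain ⟨x, y, z, h⟩ := h
  exact fun hst => prod_letter_ne_one_of_opposite (s := flip s) hst x y z h

theorem IsCorner.symm {s t : Fin 4 × Bool} (h : IsCorner s t) : IsCorner t s := by
  obtain ⟨x, y, z, h⟩ := h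
  refine ⟨flip z, flip y, flip x, ?_⟩
  simp only [List.map_cons, List.map_nil, List.prod_cons, List.prod_nil, letter_flip,
    mul_one] at h ⊢
  rw [inv_mul_eq_one] at h
  rw [h]
  group

theorem gen_conj (i : Fin 4) : (gen i)⁻¹ * gen (i + 1) * gen i = gen (i + 1) * gen (i + 1) := by
  rw [← pow_two, ← mul_inv_eq_one]
  exact gen_rel i

theorem gen_relator (i : Fin 4) :
    (gen i)⁻¹ * gen (i + 1) * gen i * (gen (i + 1))⁻¹ * (gen (i + 1))⁻¹ = 1 := by
  rw [gen_conj, mul_inv_cancel_right, mul_inv_cancel]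

theorem isCorner_succ (i : Fin 4) (δ ε : Bool) : IsCorner (i, δ) (i + 1, ε) := by
  have h := gen_relator i
  generalize ha : gen i = a at h
  generalize hb : gen (i + 1) = b at h
  cases δ <;> cases ε
  · refine ⟨(i + 1, false), (i, false), (i + 1, true), ?_⟩
    simp only [flip, Bool.not_false, List.map_cons, List.map_nil, List.prod_cons, List.prod_nil,
      letter_true, letter_false, ha, hb]
    calc _ = (a⁻¹ * b)⁻¹ * (a⁻¹ * b * a * b⁻¹ * b⁻¹) * (a⁻¹ * b) := by group
      _ = 1 := by rw [h]; group
  · refine ⟨(i + 1, true), (i, false), (i + 1, false), ?_⟩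
    simp only [flip, Bool.not_false, List.map_cons, List.map_nil, List.prod_cons, List.prod_nil,
      letter_true, letter_false, ha, hb]
    calc _ = a * (a⁻¹ * b * a * b⁻¹ * b⁻¹)⁻¹ * a⁻¹ := by simp [mul_assoc]
      _ = 1 := by rw [h]; group
  · refine ⟨(i, true), (i + 1, true), (i + 1, true), ?_⟩
    simp only [flip, Bool.not_true, List.map_cons, List.map_nil, List.prod_cons, List.prod_nil,
      letter_true, letter_false, ha, hb]
    calc _ = (b * b)⁻¹ * (a⁻¹ * b * a * b⁻¹ * b⁻¹)⁻¹ * (b * b) := by group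
      _ = 1 := by rw [h]; group
  · refine ⟨(i, true), (i + 1, false), (i + 1, false), ?_⟩
    simp only [flip, Bool.not_true, List.map_cons, List.map_nil, List.prod_cons, List.prod_nil,
      letter_true, letter_false, ha, hb]
    simpa only [mul_assoc, mul_one] using h

/-- The square in the relator makes two equal letters adjacent, so the walk passes straight through
their common vertex. -/
theorem isCorner_flip (s : Fin 4 × Bool) : IsCorner (flip s) s := by
  obtain ⟨j, ε⟩ := s
  obtain ⟨i, rfl⟩ : ∃ i, j = i + 1 := ⟨j - 1, by rw [sub_add_cancel]⟩
  have h := gen_relator i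
  refine ⟨(i, false), (i + 1, !ε), (i, true), ?_⟩
  rw [flip_flip]
  generalize ha : gen i = a at h
  generalize hb : gen (i + 1) = b at h
  cases ε
  · simp only [Bool.not_false, List.map_cons, List.map_nil, List.prod_cons, List.prod_nil,
      letter_true, letter_false, ha, hb]
    calc _ = (b * b)⁻¹ * (a⁻¹ * b * a * b⁻¹ * b⁻¹) * (b * b) := by group
      _ = 1 := by rw [h]; group
  · simp only [Bool.not_true, List.map_cons, List.map_nil, List.prod_cons, List.prod_nil,
      letter_true, letter_false, ha, hb]
    calc _ = (a⁻¹ * b * a * b⁻¹ * b⁻¹)⁻¹ := by simp [mul_assoc]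
      _ = 1 := by rw [h]; group

/-- With `IsCorner.fst_ne`, this describes opposite indices purely in terms of the graph. -/
theorem isCorner_of_ne {s t : Fin 4 × Bool} (hne : s ≠ t) (hst : t.1 ≠ s.1 + 2) :
    IsCorner s t := by
  have key : ∀ i j : Fin 4, j ≠ i + 2 → i = j ∨ j = i + 1 ∨ i = j + 1 := by decide
  obtain ⟨i, δ⟩ := s
  obtain ⟨j, ε⟩ := t
  rcases key i j hst with h | h | h
  · rw [eq_flip_of_fst_eq h hne]
    exact isCorner_flip _
  · obtain rfl := h
    exact isCorner_succ i δ ε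
  · obtain rfl := h
    exact (isCorner_succ j ε δ).symm

/-! ### Rigidity of automorphisms around a vertex -/

section Rigidity

variable (φ : cayleyGraph ≃g cayleyGraph) (v : HigmanGroup)

theorem localLetter_fst_of_opposite {s t : Fin 4 × Bool} (hst : t.1 = s.1 + 2) :
    (localLetter φ v t).1 = (localLetter φ v s).1 + 2 := by
  by_contra h
  have hne : localLetter φ v s ≠ localLetter φ v t := by
    intro h
    rw [localLetter_injective φ v h] at hst
    revert hst
    generalize t.1 = i
    revert i
    decide
  have hc := (isCorner_of_ne hne h).map φ.symm (φ v)
  rw [localLetter_symm_localLetter, localLetter_symm_localLetter] at hc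
  exact hc.fst_ne hst

/-- A letter and its inverse are opposite to the same letters, so their images share an index.
Consequently straight lines go to straight lines. -/
theorem localLetter_flip (s : Fin 4 × Bool) :
    localLetter φ v (flip s) = flip (localLetter φ v s) := by
  apply eq_flip_of_fst_eq
  · have h₁ := localLetter_fst_of_opposite φ v (s := s) (t := (s.1 + 2, true)) rfl
    have h₂ := localLetter_fst_of_opposite φ v (s := flip s) (t := (s.1 + 2, true)) rfl
    exact add_right_cancel (h₂.symm.trans h₁)
  · intro h
    have := congrArg Prod.snd (localLetter_injective φ v h)
    simp [flip] at this

theorem localLetter_relator (i : Fin 4) :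
    localLetter φ v (i, true) = ((localLetter φ v (i + 1, true)).1 - 1, true) := by
  have hrel : ([(i, false), (i + 1, true), (i, true), (i + 1, false), (i + 1, false)].map
      letter).prod = 1 := by
    simp only [List.map_cons, List.map_nil, List.prod_cons, List.prod_nil, letter_true,
      letter_false, mul_one, ← mul_assoc, gen_conj, mul_inv_cancel_right, mul_inv_cancel]
  have h := prod_walkLetters_eq_one φ v hrel
  have hw : v * (gen i)⁻¹ * gen (i + 1) * gen i = v * gen (i + 1) * gen (i + 1) := by
    rw [mul_assoc, mul_assoc, ← mul_assoc (gen i)⁻¹, gen_conj, mul_assoc]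
  have e₅ : localLetter φ (v * gen (i + 1)) (i + 1, false) =
      flip (localLetter φ v (i + 1, true)) :=
    localLetter_mul_letter_flip φ v (i + 1, true)
  -- The edges labelled `sᵢ₊₁` out of `v` and out of `v * gen (i + 1)` form a straight line, so
  -- their images carry the same label.
  have e₄ : localLetter φ (v * gen (i + 1) * gen (i + 1)) (i + 1, false) =
      flip (localLetter φ v (i + 1, true)) := by
    rw [← e₅, ← flip_flip (localLetter φ (v * gen (i + 1)) (i + 1, false)), ← localLetter_flip]
    exact localLetter_mul_letter_flip φ (v * gen (i + 1)) (i + 1, true)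
  simp only [walkLetters, letter_true, letter_false, hw, mul_inv_cancel_right, e₄, e₅] at h
  generalize localLetter φ v (i + 1, true) = y at *
  generalize localLetter φ (v * (gen i)⁻¹) (i + 1, true) = x₂ at *
  generalize localLetter φ (v * (gen i)⁻¹ * gen (i + 1)) (i, true) = x₃ at *
  -- Cyclic rotation puts the repeated letter in front, where `eq_relator_of_prod_letter_eq_one`
  -- applies.
  have h' : ([flip y, flip y, localLetter φ v (i, false), x₂, x₃].map letter).prod = 1 := by
    simp only [List.map_cons, List.map_nil, List.prod_cons, List.prod_nil, mul_one] at h ⊢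
    rw [mul_eq_one_iff_eq_inv] at h
    rw [h]
    group
  have hx := (eq_relator_of_prod_letter_eq_one h').1
  have hf := localLetter_flip φ v (i, false)
  rw [hx] at hf
  exact hf

theorem exists_localLetter_eq : ∃ k : Fin 4, ∀ s, localLetter φ v s = (s.1 + k, s.2) := by
  have key : ∀ f : Fin 4 → Fin 4, (∀ i, f i = f (i + 1) - 1) → ∀ i, f i = i + f 0 := by
    intro f hf
    have hval : ∀ p q r s : Fin 4, p = q - 1 → q = r - 1 → r = s - 1 →
        p = 0 + p ∧ q = 1 + p ∧ r = 2 + p ∧ s = 3 + p := by decide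
    obtain ⟨h₀, h₁, h₂, h₃⟩ := hval _ _ _ _ (hf 0) (hf 1) (hf 2)
    intro i
    fin_cases i
    exacts [h₀, h₁, h₂, h₃]
  refine ⟨(localLetter φ v (0, true)).1, ?_⟩
  have htrue (i : Fin 4) : localLetter φ v (i, true) =
      (i + (localLetter φ v (0, true)).1, true) := by
    have h := key (fun i => (localLetter φ v (i, true)).1)
      (fun i => congrArg Prod.fst (localLetter_relator φ v i)) i
    have h' := congrArg Prod.snd (localLetter_relator φ v i)
    exact Prod.ext h h'
  rintro ⟨i, _ | _⟩
  · have := localLetter_flip φ v (i, true)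
    rw [htrue] at this
    exact this
  · exact htrue i

end Rigidity

theorem closure_range_gen : Subgroup.closure (Set.range gen) = ⊤ :=
  PresentedGroup.closure_range_of relators

/-- Every automorphism of the Cayley graph is a rotation followed by a left translation. -/
theorem exists_eq_mul_rotationHom (φ : cayleyGraph ≃g cayleyGraph) :
    ∃ k : Fin 4, ∀ v, φ v = φ 1 * rotationHom k v := by
  choose k hk using exists_localLetter_eq φ
  -- The image of an edge has inverse labels at its two ends, so the shift agrees at adjacent
  -- vertices.
  have hstep (v : HigmanGroup) (s : Fin 4 × Bool) : k (v * letter s) = k v := by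
    have h := localLetter_mul_letter_flip φ v s
    rw [hk, hk] at h
    exact add_left_cancel (congrArg Prod.fst h)
  refine ⟨k 1, fun v => ?_⟩
  suffices h : k v = k 1 ∧ φ v = φ 1 * rotationHom (k 1) v from h.2
  have hv : v ∈ Subgroup.closure (Set.range gen) := closure_range_gen ▸ Subgroup.mem_top v
  have hletter (w : HigmanGroup) (s : Fin 4 × Bool)
      (h : k w = k 1 ∧ φ w = φ 1 * rotationHom (k 1) w) :
      k (w * letter s) = k 1 ∧ φ (w * letter s) = φ 1 * rotationHom (k 1) (w * letter s) := by
    refine ⟨(hstep w s).trans h.1, ?_⟩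
    rw [map_mul_letter, hk, h.1, h.2, map_mul, rotationHom_letter, mul_assoc]
  induction hv using Subgroup.closure_induction_right with
  | one => simp
  | mul_right x hx y hy ih =>
    obtain ⟨i, rfl⟩ := hy
    exact hletter x (i, true) ih
  | mul_inv_cancel x hx y hy ih =>
    obtain ⟨i, rfl⟩ := hy
    exact hletter x (i, false) ih

theorem rotationHom_rotationHom (k l : Fin 4) (v : HigmanGroup) :
    rotationHom l (rotationHom k v) = rotationHom (k + l) v := by
  have : (rotationHom l).comp (rotationHom k) = rotationHom (k + l) := by
    apply PresentedGroup.ext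
    intro i
    change rotationHom l (rotationHom k (gen i)) = rotationHom (k + l) (gen i)
    rw [rotationHom_gen, rotationHom_gen, rotationHom_gen, add_assoc]
  exact DFunLike.congr_fun this v

theorem rotationHom_zero (v : HigmanGroup) : rotationHom 0 v = v := by
  have h := rotationHom_comp 0 0 rfl
  have h' := DFunLike.congr_fun h v
  simpa [rotationHom_rotationHom] using h'

theorem rotation_pow_apply (n : ℕ) (v : HigmanGroup) :
    (rotation ^ n) v = rotationHom (Fin.ofNat 4 n) v := by
  induction n with
  | zero => exact (rotationHom_zero v).symm
  | succ n ih =>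
    rw [pow_succ', RelIso.mul_apply, ih]
    change rotationHom 1 _ = _
    rw [rotationHom_rotationHom]
    have hn : Fin.ofNat 4 n + 1 = Fin.ofNat 4 (n + 1) := by
      apply Fin.ext
      simp [Fin.ofNat, Fin.val_add]
    rw [hn]

theorem stabilizer_one_eq :
    MulAction.stabilizer (cayleyGraph ≃g cayleyGraph) (1 : HigmanGroup) =
      Subgroup.zpowers rotation := by
  apply le_antisymm
  · intro φ hφ
    have h1 : φ 1 = 1 := hφ
    obtain ⟨k, hk⟩ := exists_eq_mul_rotationHom φ
    refine ⟨(k : ℕ), ?_⟩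
    ext v
    change (rotation ^ ((k : ℕ) : ℤ)) v = φ v
    rw [zpow_natCast, rotation_pow_apply, hk, h1, one_mul, Fin.ofNat_val_eq_self]
  · rw [Subgroup.zpowers_le]
    exact map_one (rotationHom 1)

end Higman


namespace Higman

/-! ### Finite quotients and height functions -/

theorem conj_pow_eq {Q : Type*} [Group Q] {x y : Q} (h : x⁻¹ * y * x = y ^ 2) (n : ℕ) :
    (x ^ n)⁻¹ * y * x ^ n = y ^ 2 ^ n := by
  induction n with
  | zero => simp
  | succ n ih =>
    calc (x ^ (n + 1))⁻¹ * y * x ^ (n + 1) = x⁻¹ * ((x ^ n)⁻¹ * y * x ^ n) * x := by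
          rw [pow_succ]
          group
      _ = (x⁻¹ * y * x) ^ 2 ^ n := by
          rw [ih]
          simpa using (conj_pow (a := x⁻¹) (b := y) (i := 2 ^ n)).symm
      _ = y ^ 2 ^ (n + 1) := by rw [h, ← pow_mul, pow_succ']

theorem orderOf_dvd_two_pow_sub_one {Q : Type*} [Group Q] {x y : Q}
    (h : x⁻¹ * y * x = y ^ 2) : orderOf y ∣ 2 ^ orderOf x - 1 := by
  have hx := conj_pow_eq h (orderOf x)
  rw [pow_orderOf_eq_one, inv_one, one_mul, mul_one] at hx
  apply orderOf_dvd_of_pow_eq_one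
  rw [← mul_left_inj y, ← pow_succ, Nat.sub_add_cancel Nat.one_le_two_pow, ← hx, one_mul]

/-- Positive integers with `nᵢ₊₁ ∣ 2 ^ nᵢ - 1` in a cycle are all equal to `1`. -/
theorem eq_one_of_dvd_two_pow_sub_one {ι : Type*} (σ : ι → ι) (n : ι → ℕ)
    (h0 : ∀ i, n i ≠ 0) (hσ : Function.Surjective σ)
    (h : ∀ i, n (σ i) ∣ 2 ^ n i - 1) (i : ι) : n i = 1 := by
  have key : ∀ p : ℕ, p.Prime → ∀ i, ¬ p ∣ n i := by
    intro p
    induction p using Nat.strong_induction_on with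
    | _ p ih =>
      intro hp i hpi
      obtain ⟨j, rfl⟩ := hσ i
      have : Fact p.Prime := ⟨hp⟩
      have hdvd : p ∣ 2 ^ n j - 1 := hpi.trans (h j)
      have hone : (2 : ZMod p) ^ n j = 1 := by
        rw [← ZMod.natCast_eq_zero_iff, Nat.cast_sub Nat.one_le_two_pow] at hdvd
        push_cast at hdvd
        exact sub_eq_zero.1 hdvd
      have h2 : (2 : ZMod p) ≠ 0 := by
        intro h2
        rw [h2, zero_pow (h0 j)] at hone
        exact zero_ne_one hone
      have hord : orderOf (2 : ZMod p) ≠ 1 := by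
        intro h1
        rw [orderOf_eq_one_iff] at h1
        have : (1 : ZMod p) = 0 := by linear_combination h1
        exact one_ne_zero this
      -- Any prime factor of the order of 2 modulo `p` is smaller than `p` by Fermat and divides `n
      -- j`, so the strong induction applies.
      have hlt : orderOf (2 : ZMod p) ≤ p - 1 :=
        Nat.le_of_dvd (Nat.sub_pos_of_lt hp.one_lt)
          (orderOf_dvd_of_pow_eq_one (ZMod.pow_card_sub_one_eq_one h2))
      have hpos : 0 < orderOf (2 : ZMod p) :=
        Nat.pos_of_dvd_of_pos (orderOf_dvd_of_pow_eq_one hone) (Nat.pos_of_ne_zero (h0 j))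
      have hle := Nat.minFac_le hpos
      have hp1 := hp.one_lt
      exact ih _ (by omega) (Nat.minFac_prime hord) j
        ((Nat.minFac_dvd _).trans (orderOf_dvd_of_pow_eq_one hone))
  by_contra hi
  exact key _ (Nat.minFac_prime hi) i (Nat.minFac_dvd _)

/-- The Higman group has no proper normal subgroup of finite index. -/
theorem eq_top_of_normal_of_finiteIndex (N : Subgroup HigmanGroup) (hN : N.Normal)
    (hfin : N.FiniteIndex) : N = ⊤ := by
  have hone := eq_one_of_dvd_two_pow_sub_one (fun i : Fin 4 => i + 1)
    (fun i => orderOf (gen i : HigmanGroup ⧸ N)) (fun i => (orderOf_pos _).ne')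
    (fun i => ⟨i - 1, sub_add_cancel i 1⟩) (fun i => orderOf_dvd_two_pow_sub_one (by
      rw [pow_two]
      exact congrArg (QuotientGroup.mk' N) (gen_conj i)))
  rw [eq_top_iff, ← closure_range_gen, Subgroup.closure_le]
  rintro _ ⟨i, rfl⟩
  exact (QuotientGroup.eq_one_iff _).1 (orderOf_eq_one_iff.1 (hone i))

theorem eq_top_of_finiteIndex (K : Subgroup HigmanGroup) [K.FiniteIndex] : K = ⊤ := by
  have h := eq_top_of_normal_of_finiteIndex K.normalCore inferInstance inferInstance
  exact top_le_iff.1 (h ▸ K.normalCore_le)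

/-! ### Trivial abelianisation and height functions -/

theorem map_gen_eq_one {A : Type*} [CommGroup A] (f : HigmanGroup →* A) (i : Fin 4) :
    f (gen i) = 1 := by
  have h := congrArg f (gen_conj (i - 1))
  rw [sub_add_cancel, map_mul, map_mul, map_mul, map_inv, mul_comm _ (f (gen i)), mul_assoc,
    mul_right_inj, inv_mul_cancel] at h
  exact h.symm

theorem hom_eq_one {A : Type*} [CommGroup A] (f : HigmanGroup →* A) (x : HigmanGroup) :
    f x = 1 := by
  have : f = 1 := PresentedGroup.ext fun i => map_gen_eq_one f i
  rw [this, MonoidHom.one_apply]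

theorem not_isGroupHeightFunction (h : HigmanGroup → ℤ) : ¬ IsGroupHeightFunction generators h := by
  intro hh
  have hexists (x : HigmanGroup) : ∃ l : List HigmanGroup, (∀ s ∈ l, s ∈ generators) ∧
      l.prod = x := by
    have hx : x ∈ Subgroup.closure (Set.range gen) := closure_range_gen ▸ Subgroup.mem_top x
    rw [← Subgroup.mem_toSubmonoid, Subgroup.closure_toSubmonoid] at hx
    obtain ⟨l, hl, rfl⟩ := Submonoid.exists_list_of_mem_closure hx
    refine ⟨l, fun s hs => ?_, rfl⟩
    rcases hl s hs with ⟨i, hi⟩ | ⟨i, hi⟩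
    · exact ⟨i, Or.inl hi.symm⟩
    · exact ⟨i, Or.inr (by rw [hi, inv_inv])⟩
  let f : HigmanGroup →* Multiplicative ℤ :=
    MonoidHom.mk' (fun x => Multiplicative.ofAdd (h x)) (by
      intro x y
      obtain ⟨l, hl, rfl⟩ := hexists x
      obtain ⟨m, hm, rfl⟩ := hexists y
      rw [← List.prod_append, hh.map_prod (l ++ m), hh.map_prod l hl, hh.map_prod m hm,
        List.map_append, List.sum_append, ofAdd_add]
      intro s hs
      exact (List.mem_append.1 hs).elim (hl s) (hm s))
  obtain ⟨γ, hγ⟩ := hh.ne_zero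
  exact hγ (congrArg Multiplicative.toAdd (hom_eq_one f γ))

/-- The action of the Higman group on its Cayley graph by left translations. -/
def leftTranslation : HigmanGroup →* (cayleyGraph ≃g cayleyGraph) where
  toFun γ :=
    { toEquiv := Equiv.mulLeft γ
      map_rel_iff' := by
        intro u v
        simp only [cayleyGraph_adj_iff, Equiv.coe_mulLeft, mul_assoc, mul_right_inj] }
  map_one' := by
    ext v
    exact one_mul v
  map_mul' x y := by
    ext v
    exact mul_assoc x y v

theorem leftTranslation_apply (γ v : HigmanGroup) : leftTranslation γ v = γ * v := rfl

/-- Bringing `γ` into the finite set `W` by an element of `H` leaves a point of `W` and a rotation,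
hence finitely many possibilities. Equal data differ by an element of `H`, so the translations in
`H` have finite index. -/
theorem leftTranslation_mem_of_quasiTransitive {H : Subgroup (cayleyGraph ≃g cayleyGraph)}
    (hH : ActsQuasiTransitively cayleyGraph H) (γ : HigmanGroup) : leftTranslation γ ∈ H := by
  obtain ⟨W, hW, hmeet⟩ := hH
  choose α hα w hw hαw using hmeet
  have hrot (γ : HigmanGroup) := exists_eq_mul_rotationHom (α γ * leftTranslation γ)
  choose k hk using hrot
  have hk' (γ v : HigmanGroup) : α γ (γ * v) = w γ * rotationHom (k γ) v := by
    have h := hk γ v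
    simp only [RelIso.mul_apply, leftTranslation_apply, mul_one, hαw] at h
    exact h
  have : Finite W := hW
  let K : Subgroup HigmanGroup := H.comap leftTranslation
  -- The inverses make the fibres of `F` lie in left cosets of `K`, as `HigmanGroup ⧸ K` requires.
  let F : HigmanGroup → W × Fin 4 := fun γ => (⟨w γ⁻¹, hw γ⁻¹⟩, k γ⁻¹)
  have hF (x y : HigmanGroup) (hxy : F x = F y) : x⁻¹ * y ∈ K := by
    have hw' : w x⁻¹ = w y⁻¹ := congrArg (fun p => (p.1 : HigmanGroup)) hxy
    have hk'' : k x⁻¹ = k y⁻¹ := congrArg Prod.snd hxy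
    have heq : leftTranslation (x⁻¹ * y) = (α x⁻¹)⁻¹ * α y⁻¹ := by
      rw [eq_inv_mul_iff_mul_eq]
      ext v
      rw [RelIso.mul_apply, leftTranslation_apply, mul_assoc, hk', hw', hk'', ← hk',
        inv_mul_cancel_left]
    change leftTranslation (x⁻¹ * y) ∈ H
    rw [heq]
    exact mul_mem (inv_mem (hα _)) (hα _)
  have hfin : Finite (HigmanGroup ⧸ K) := by
    refine Finite.of_injective (fun q : HigmanGroup ⧸ K => F q.out) ?_
    intro q r hqr
    rw [← q.out_eq', ← r.out_eq']
    exact QuotientGroup.eq.2 (hF _ _ hqr)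
  have hindex : K.FiniteIndex := Subgroup.finiteIndex_of_finite_quotient
  have hγ : γ ∈ K := by
    rw [eq_top_of_finiteIndex K]
    trivial
  exact hγ

theorem not_isGraphHeightFunction (h : HigmanGroup → ℤ)
    (H : Subgroup (cayleyGraph ≃g cayleyGraph)) : ¬ IsGraphHeightFunction cayleyGraph 1 h H := by
  intro hh
  let f : HigmanGroup →* Multiplicative ℤ :=
    MonoidHom.mk' (fun x => Multiplicative.ofAdd (h x)) (by
      intro x y
      have hd := hh.differenceInvariant y 1 _
        (leftTranslation_mem_of_quasiTransitive hh.quasiTransitive x)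
      rw [leftTranslation_apply, leftTranslation_apply, mul_one, hh.map_origin] at hd
      rw [← ofAdd_add]
      congr 1
      linarith)
  have hzero (x : HigmanGroup) : h x = 0 := congrArg Multiplicative.toAdd (hom_eq_one f x)
  obtain ⟨u, w, -, -, hu, -⟩ := hh.exists_lt_lt 1
  rw [hzero, hzero] at hu
  exact lt_irrefl _ hu

end Higman

/-- The Cayley graph of the Higman group has no graph height function. Moreover the group has no
group height function, the stabiliser of the identity vertex in the automorphism group of the
Cayley graph is the cyclic group generated by the rotation of the generators, and the group has
no proper normal subgroup of finite index. -/
theorem mainTheorem5 :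
    (¬ ∃ (h : Higman.HigmanGroup → ℤ) (H : Subgroup (Higman.cayleyGraph ≃g Higman.cayleyGraph)),
      IsGraphHeightFunction Higman.cayleyGraph 1 h H) ∧
    (¬ ∃ h : Higman.HigmanGroup → ℤ, IsGroupHeightFunction Higman.generators h) ∧
    MulAction.stabilizer (Higman.cayleyGraph ≃g Higman.cayleyGraph) (1 : Higman.HigmanGroup) =
      Subgroup.zpowers Higman.rotation ∧
    (∀ N : Subgroup Higman.HigmanGroup, N.Normal → N.FiniteIndex → N = ⊤) := by
  refine ⟨?_, ?_, Higman.stabilizer_one_eq, Higman.eq_top_of_normal_of_finiteIndex⟩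
  · rintro ⟨h, H, hh⟩
    exact Higman.not_isGraphHeightFunction h H hh
  · rintro ⟨h, hh⟩
    exact Higman.not_isGroupHeightFunction h hh
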